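/- Let $X$ be a topological space. A topological filter on $X$ is a set $F$ of open subsets of $X$ that contains $X$, is closed under finite intersections, and contains with an open set every larger open set. It is called irreducible if for every family $(U_i)_{i\in I}$ of open sets (the empty family included) $\bigcup_{i\in I}U_i\in F$ implies $U_i\in F$ for some $i\in I$. The filtrum $\mathrm{Filt}\,X$ is the set of all topological filters on $X$ with the topology that has the sets $D(U)=\{F : U\in F\}$, $U\subseteq X$ open, as a basis, and $i: X\to \mathrm{Filt}\,X$ is the continuous map that sends a point $x$ to the filter of its open neighbourhoods. For a sheaf $\mathcal G$ of abelian groups on $X$ and a topological filter $F$, the generalized stalk is $\mathcal G_F=\varinjlim_{U\in F}\mathcal G(U)$, and for $n\geq 1$ the $n$-th cohomology sheaf of $\mathcal G$ is the higher direct image $R^n i_*\mathcal G$ on $\mathrm{Filt}\,X$. Let $F$ be an irreducible topological filter on $X$. Then: (1) For every exact sequence $\mathcal F\to\mathcal G\to\mathcal H$ of sheaves of abelian groups on $X$, the sequence of generalized stalks $\mathcal F_F\to\mathcal G_F\to\mathcal H_F$ is exact. (2) For every sheaf $\mathcal G$ of abelian groups on $X$ and every $n\geq 1$, the cohomology sheaf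 $R^n i_*\mathcal G$ vanishes at $F$, that is, its stalk $(R^n i_*\mathcal G)_F$ at the point $F\in\mathrm{Filt}\,X$ is zero. -/

import Mathlib

open CategoryTheory CategoryTheory.Limits TopologicalSpace Opposite

universe u

/-- The commutative monoid `Top(X)` of open sets of `X`: the product is the intersection, and the
neutral element is the whole space. -/
instance Opens.instCommMonoidInter (X : Type u) [TopologicalSpace X] : CommMonoid (Opens X) where
  mul U V := U ⊓ V
  one := ⊤
  mul_assoc := inf_assoc
  mul_comm := inf_comm
  one_mul := top_inf_eq
  mul_one := inf_top_eq

/-- A filter of a commutative monoid `M`: a subset that contains `1`, is closed under products,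
and contains all divisors of its elements, that is, a saturated submonoid. -/
abbrev MonoidFilter (M : Type u) [CommMonoid M] : Type u := SaturatedSubmonoid M

namespace MonoidFilter

theorem mem_of_dvd {M : Type u} [CommMonoid M] (F : MonoidFilter M) {f g : M} (hf : f ∈ F)
    (h : g ∣ f) : g ∈ F := by
  obtain ⟨c, rfl⟩ := h
  exact (F.mulSaturated hf).1

/-- The basic open set `D(f)` of all filters that contain `f`. -/
def basicOpen {M : Type u} [CommMonoid M] (f : M) : Set (MonoidFilter M) :=
  {F | f ∈ F}

/-- The filtrum of a commutative monoid `M` is the set of its filters with the topology that is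
generated by the sets `D(f)`. -/
instance (M : Type u) [CommMonoid M] : TopologicalSpace (MonoidFilter M) :=
  TopologicalSpace.generateFrom (Set.range basicOpen)

/-- `D(f * g) = D(f) ∩ D(g)`, so the sets `D(f)` form a basis. -/
theorem basicOpen_mul {M : Type u} [CommMonoid M] (f g : M) :
    basicOpen (f * g) = basicOpen f ∩ basicOpen g := by
  ext F
  exact F.mulSaturated.mul_mem_iff

end MonoidFilter

/-- A topological filter of `X` is a filter of the monoid of open sets of `X`; the space of all
topological filters is the filtrum of `X`. -/
abbrev TopFilter (X : Type u) [TopologicalSpace X] : Type u := MonoidFilter (Opens X)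

namespace TopFilter

/-- For open sets, divisibility is the superset relation. -/
theorem dvd_iff {X : Type u} [TopologicalSpace X] (U V : Opens X) : V ∣ U ↔ U ≤ V := by
  constructor
  · rintro ⟨W, rfl⟩
    exact inf_le_left
  · intro h
    exact ⟨U, (inf_eq_right.mpr h).symm⟩

/-- A topological filter is irreducible if, whenever it contains the union of a family of open
sets, it contains a member of the family. The empty family is allowed. -/
def IsIrreducible {X : Type u} [TopologicalSpace X] (F : TopFilter X) : Prop :=
  ∀ S : Set (Opens X), sSup S ∈ F → ∃ U ∈ S, U ∈ F

/-- The filter of open neighbourhoods of a point. -/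
def nhdsFilter {X : Type u} [TopologicalSpace X] (x : X) : TopFilter X where
  carrier := {U | x ∈ U}
  one_mem' := Opens.mem_top x
  mul_mem' hU hV := ⟨hU, hV⟩
  mulSaturated _ _ h := h

theorem continuous_nhdsFilter (X : Type u) [TopologicalSpace X] :
    Continuous (nhdsFilter : X → TopFilter X) := by
  refine continuous_generateFrom_iff.mpr ?_
  rintro _ ⟨U, rfl⟩
  exact U.isOpen

end TopFilter

/-- The filtrum of a topological space, as an object of the category of topological spaces. -/
abbrev filtrum (X : TopCat.{u}) : TopCat.{u} := TopCat.of (TopFilter X)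

/-- The canonical continuous map `i : X ⟶ Filt X` that takes a point to its filter of open
neighbourhoods. -/
def toFiltrum (X : TopCat.{u}) : X ⟶ filtrum X :=
  TopCat.ofHom ⟨TopFilter.nhdsFilter, TopFilter.continuous_nhdsFilter X⟩

/-- The generalized stalk `G_F = colim_{U ∈ F} G(U)` of abelian sheaves `G` on `X` in a topological
filter `F`, as a functor of `G`. -/
noncomputable def generalizedStalk {X : TopCat.{u}} (F : TopFilter X) :
    TopCat.Sheaf AddCommGrpCat.{u} X ⥤ AddCommGrpCat.{u} :=
  TopCat.Sheaf.forget AddCommGrpCat.{u} X ⋙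
    (Functor.whiskeringLeft _ _ AddCommGrpCat.{u}).obj
      (ObjectProperty.ι (fun U : Opens X => U ∈ F)).op ⋙ colim

instance pushforward_additive {X Y : TopCat.{u}} (f : X ⟶ Y) :
    (TopCat.Sheaf.pushforward AddCommGrpCat.{u} f).Additive where
  map_add := rfl

/-- The higher direct image functor `R^n f_*` on sheaves of abelian groups. -/
noncomputable def higherDirectImage {X Y : TopCat.{u}} (f : X ⟶ Y) (n : ℕ) :
    TopCat.Sheaf AddCommGrpCat.{u} X ⥤ TopCat.Sheaf AddCommGrpCat.{u} Y :=
  (TopCat.Sheaf.pushforward AddCommGrpCat.{u} f).rightDerived n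

/-- The `n`-th cohomology sheaf of `G`: the sheaf `R^n i_* G` on the filtrum of `X`. -/
noncomputable def cohomologySheaf {X : TopCat.{u}} (n : ℕ)
    (G : TopCat.Sheaf AddCommGrpCat.{u} X) : TopCat.Sheaf AddCommGrpCat.{u} (filtrum X) :=
  (higherDirectImage (toFiltrum X) n).obj G

/-!
The generalized stalk at an irreducible filter `F` is an exact functor for the same reason that an
ordinary stalk is. If `𝓕 ⟶ 𝓖 ⟶ 𝓗` is exact and a section `s` of `𝓖` over `V ∈ F` dies in `𝓗`, the
open sets over which `s` comes from `𝓕` cover `V`; their union lies in `F`, so irreducibility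
provides one of them in `F` (`TopFilter.IsIrreducible.exists_preimage_of_exact`). Every element of a
generalized stalk, and every relation between such elements, is represented over a member of `F`,
which gives `generalizedStalk.exact_of_isIrreducible`.

For the cohomology sheaves, the sets `D(U)` with `U ∈ F` form a neighbourhood basis of the point
`F` of the filtrum, and the preimage of `D(U)` under `i : X ⟶ Filt X` is `U`. So the stalk of `i_* 𝓖`
at `F` consists of germs of sections of `𝓖` over members of `F`, and the same lifting argument
shows that `𝓖 ↦ (i_* 𝓖)_F` is exact (`TopFilter.IsIrreducible.exact_stalk_pushforward`). Stalks of
sheaves commute with homology, so `(R^n i_* 𝓖)_F` is the homology in degree `n` of the complex of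
stalks `(i_* I)_F` for an injective resolution `I` of `𝓖`, and this complex is exact in positive
degrees (`isZero_stalk_higherDirectImage_of_exact`).
-/

section

variable {X : TopCat.{u}}

/-- In an exact sequence of abelian sheaves, a section of the middle term that maps to zero lifts
locally to the first term. -/
theorem TopCat.Sheaf.exists_local_preimage_of_exact
    {S : ShortComplex (TopCat.Sheaf AddCommGrpCat.{u} X)} (hS : S.Exact) {V : Opens X}
    (s : S.X₂.obj.obj (op V)) (hs : S.g.hom.app (op V) s = 0) {x : X} (hx : x ∈ V) :
    ∃ (W : Opens X) (h : W ≤ V) (t : S.X₁.obj.obj (op W)), x ∈ W ∧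
      S.f.hom.app (op W) t = S.X₂.obj.map (homOfLE h).op s := by
  have hex := (TopCat.Sheaf.exact_iff_stalkFunctor_map_exact S).1 hS x
  rw [ShortComplex.ab_exact_iff] at hex
  obtain ⟨y, hy⟩ := hex (S.X₂.presheaf.germ V x hx s) (by
    change (TopCat.Presheaf.stalkFunctor _ x).map S.g.hom (S.X₂.presheaf.germ V x hx s) = 0
    rw [TopCat.Presheaf.stalkFunctor_map_germ_apply, hs]
    exact map_zero (S.X₃.presheaf.germ V x hx).hom)
  obtain ⟨W, hW, t, rfl⟩ := TopCat.Presheaf.exists_germ_eq S.X₁.obj y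
  change (TopCat.Presheaf.stalkFunctor _ x).map S.f.hom (S.X₁.presheaf.germ W x hW t) = _ at hy
  rw [TopCat.Presheaf.stalkFunctor_map_germ_apply] at hy
  obtain ⟨W', hW', i, j, h⟩ := TopCat.Presheaf.germ_eq S.X₂.obj x hW hx _ _ hy
  refine ⟨W', j.le, S.X₁.obj.map i.op t, hW', ?_⟩
  exact (NatTrans.naturality_apply S.f.hom i.op t).trans h

namespace TopFilter

theorem mem_of_le {F : TopFilter X} {U V : Opens X} (hU : U ∈ F) (h : U ≤ V) : V ∈ F :=
  F.mem_of_dvd hU ((dvd_iff U V).2 h)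

theorem inf_mem {F : TopFilter X} {U V : Opens X} (hU : U ∈ F) (hV : V ∈ F) : U ⊓ V ∈ F :=
  F.mul_mem' hU hV

/-- The lifting property behind both exactness statements: in an exact sequence of abelian sheaves,
a section over a member of an irreducible filter that maps to zero lifts to the first term after
restriction to a smaller member of the filter. -/
theorem IsIrreducible.exists_preimage_of_exact {F : TopFilter X} (hF : F.IsIrreducible)
    {S : ShortComplex (TopCat.Sheaf AddCommGrpCat.{u} X)} (hS : S.Exact) {V : Opens X}
    (hV : V ∈ F) (s : S.X₂.obj.obj (op V)) (hs : S.g.hom.app (op V) s = 0) :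
    ∃ (W : Opens X) (h : W ≤ V) (t : S.X₁.obj.obj (op W)), W ∈ F ∧
      S.f.hom.app (op W) t = S.X₂.obj.map (homOfLE h).op s := by
  -- The open sets over which `s` lifts cover `V`, so irreducibility applies to their union.
  let C : Set (Opens X) := {W | ∃ (h : W ≤ V) (t : S.X₁.obj.obj (op W)),
    S.f.hom.app (op W) t = S.X₂.obj.map (homOfLE h).op s}
  have hC : sSup C ∈ F := by
    refine mem_of_le hV fun x hx ↦ ?_
    obtain ⟨W, h, t, hxW, ht⟩ := TopCat.Sheaf.exists_local_preimage_of_exact hS s hs hx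
    exact Opens.mem_sSup.2 ⟨W, ⟨h, t, ht⟩, hxW⟩
  obtain ⟨W, ⟨h, t, ht⟩, hW⟩ := hF C hC
  exact ⟨W, h, t, hW, ht⟩

instance isCofiltered_fullSubcategory (F : TopFilter X) :
    IsCofiltered (ObjectProperty.FullSubcategory fun U : Opens X => U ∈ F) where
  nonempty := ⟨⟨⊤, F.one_mem'⟩⟩
  cone_objs U V := ⟨⟨U.1 ⊓ V.1, inf_mem U.2 V.2⟩,
    ObjectProperty.homMk (homOfLE inf_le_left), ObjectProperty.homMk (homOfLE inf_le_right),
    trivial⟩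
  cone_maps U _ _ _ := ⟨U, 𝟙 U, ObjectProperty.hom_ext _ (Subsingleton.elim _ _)⟩

end TopFilter

/-- The image in the generalized stalk of a section over a member of the filter. -/
noncomputable def generalizedGerm (F : TopFilter X) (G : TopCat.Sheaf AddCommGrpCat.{u} X)
    (U : Opens X) (hU : U ∈ F) : G.obj.obj (op U) ⟶ (generalizedStalk F).obj G :=
  colimit.ι ((ObjectProperty.ι (fun U : Opens X => U ∈ F)).op ⋙ G.obj) (op ⟨U, hU⟩)

namespace generalizedStalk

variable {F : TopFilter X} {G H : TopCat.Sheaf AddCommGrpCat.{u} X}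

theorem exists_germ_eq (y : (generalizedStalk F).obj G) :
    ∃ (U : Opens X) (hU : U ∈ F) (s : G.obj.obj (op U)), generalizedGerm F G U hU s = y := by
  obtain ⟨⟨U, hU⟩, s, hs⟩ := Concrete.colimit_exists_rep
    ((ObjectProperty.ι (fun U : Opens X => U ∈ F)).op ⋙ G.obj) y
  exact ⟨U, hU, s, hs⟩

theorem germ_res_apply {U V : Opens X} (hU : U ∈ F) (hV : V ∈ F) (h : V ≤ U)
    (s : G.obj.obj (op U)) :
    generalizedGerm F G V hV (G.obj.map (homOfLE h).op s) = generalizedGerm F G U hU s :=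
  ConcreteCategory.congr_hom
    (colimit.w ((ObjectProperty.ι (fun U : Opens X => U ∈ F)).op ⋙ G.obj)
      (ObjectProperty.homMk (homOfLE h) :
        (⟨V, hV⟩ : ObjectProperty.FullSubcategory fun U : Opens X => U ∈ F) ⟶ ⟨U, hU⟩).op) s

theorem map_germ_apply (f : G ⟶ H) {U : Opens X} (hU : U ∈ F) (s : G.obj.obj (op U)) :
    (generalizedStalk F).map f (generalizedGerm F G U hU s) =
      generalizedGerm F H U hU (f.hom.app (op U) s) :=
  ConcreteCategory.congr_hom
    (ι_colimMap (Functor.whiskerLeft (ObjectProperty.ι (fun U : Opens X => U ∈ F)).op f.hom)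
      (op ⟨U, hU⟩)) s

theorem exists_res_eq_zero {U : Opens X} (hU : U ∈ F) (s : G.obj.obj (op U))
    (hs : generalizedGerm F G U hU s = 0) :
    ∃ (V : Opens X) (h : V ≤ U), V ∈ F ∧ G.obj.map (homOfLE h).op s = 0 := by
  obtain ⟨⟨V, hV⟩, i, j, h⟩ := (Concrete.colimit_rep_eq_iff_exists
    ((ObjectProperty.ι (fun U : Opens X => U ∈ F)).op ⋙ G.obj)
    (i := op ⟨U, hU⟩) (j := op ⟨U, hU⟩) s 0).1
    (hs.trans (map_zero (generalizedGerm F G U hU).hom).symm)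
  exact ⟨V, i.unop.hom.le, hV, h.trans (map_zero (G.obj.map j.unop.hom.op).hom)⟩

theorem exact_of_isIrreducible (hF : F.IsIrreducible)
    {S : ShortComplex (TopCat.Sheaf AddCommGrpCat.{u} X)} (hS : S.Exact) :
    Function.Exact ((generalizedStalk F).map S.f) ((generalizedStalk F).map S.g) := by
  refine fun y ↦ ⟨fun hy ↦ ?_, ?_⟩
  · obtain ⟨U, hU, s, rfl⟩ := exists_germ_eq y
    rw [map_germ_apply] at hy
    obtain ⟨V, h, hV, hs⟩ := exists_res_eq_zero hU _ hy
    obtain ⟨W, h', t, hW, ht⟩ := hF.exists_preimage_of_exact hS hV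
      (S.X₂.obj.map (homOfLE h).op s) ((NatTrans.naturality_apply S.g.hom _ s).trans hs)
    refine ⟨generalizedGerm F S.X₁ W hW t, ?_⟩
    rw [map_germ_apply, ht, germ_res_apply hV, germ_res_apply hU]
  · rintro ⟨x, rfl⟩
    rw [← ConcreteCategory.comp_apply, ← Functor.map_comp, S.zero]
    obtain ⟨U, hU, s, rfl⟩ := exists_germ_eq x
    rw [map_germ_apply]
    exact map_zero (generalizedGerm F S.X₃ U hU).hom

end generalizedStalk

namespace TopFilter

/-- The basic open set `D(U)` of `Filt X`, consisting of the filters that contain `U`. -/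
def basicOpens (U : Opens X) : Opens (filtrum X) :=
  ⟨MonoidFilter.basicOpen U, isOpen_generateFrom_of_mem ⟨U, rfl⟩⟩

theorem isBasis_range_basicOpens : Opens.IsBasis (Set.range (basicOpens (X := X))) := by
  have h : ((↑) : Opens (filtrum X) → Set (filtrum X)) '' Set.range (basicOpens (X := X)) =
      Set.range MonoidFilter.basicOpen := by
    rw [← Set.range_comp]; rfl
  rw [Opens.IsBasis, h]
  refine ⟨?_, ?_, rfl⟩
  · rintro _ ⟨U, rfl⟩ _ ⟨V, rfl⟩ F hF
    rw [← MonoidFilter.basicOpen_mul] at hF ⊢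
    exact ⟨_, ⟨U * V, rfl⟩, hF, subset_rfl⟩
  · exact Set.sUnion_eq_univ_iff.2 fun F ↦ ⟨_, ⟨1, rfl⟩, F.one_mem'⟩

/-- For an irreducible filter `F`, the functor `G ↦ (i_* G)_F` is exact. -/
theorem IsIrreducible.exact_stalk_pushforward {F : TopFilter X} (hF : F.IsIrreducible)
    {S : ShortComplex (TopCat.Sheaf AddCommGrpCat.{u} X)} (hS : S.Exact) :
    ((S.map (TopCat.Sheaf.pushforward AddCommGrpCat.{u} (toFiltrum X))).map
      (TopCat.Sheaf.forget _ _ ⋙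
        TopCat.Presheaf.stalkFunctor AddCommGrpCat.{u} (F : filtrum X))).Exact := by
  rw [ShortComplex.ab_exact_iff]
  set T := S.map (TopCat.Sheaf.pushforward AddCommGrpCat.{u} (toFiltrum X))
  intro y hy
  obtain ⟨_, hU, ⟨U, rfl⟩, s, rfl⟩ :=
    TopCat.Presheaf.exists_mem_germ_eq_of_isBasis isBasis_range_basicOpens T.X₂.obj F y
  change (TopCat.Presheaf.stalkFunctor _ F).map T.g.hom (T.X₂.presheaf.germ _ F hU s) = 0 at hy
  rw [TopCat.Presheaf.stalkFunctor_map_germ_apply] at hy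
  obtain ⟨_, hV, ⟨V, rfl⟩, h, _, hs⟩ :=
    TopCat.Presheaf.germ_eq_of_isBasis isBasis_range_basicOpens T.X₃.obj F hU hU
      (hy.trans (map_zero (T.X₃.presheaf.germ _ F hU).hom).symm)
  replace hs := hs.trans (map_zero (T.X₃.obj.map (homOfLE h).op).hom)
  -- Sections of `i_* G` over `D(V)` are, by definition, sections of `G` over `V`.
  obtain ⟨W, h', t, hW, ht⟩ := hF.exists_preimage_of_exact hS (V := V) hV
    (T.X₂.obj.map (homOfLE h).op s) ((NatTrans.naturality_apply T.g.hom _ s).trans hs)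
  have h'' : basicOpens W ≤ basicOpens V := fun E hE ↦ mem_of_le (F := E) hE h'
  refine ⟨T.X₁.presheaf.germ (basicOpens W) F hW t, ?_⟩
  have ht' : T.f.hom.app (op (basicOpens W)) t =
    T.X₂.obj.map (homOfLE h'').op (T.X₂.obj.map (homOfLE h).op s) := ht
  refine (TopCat.Presheaf.stalkFunctor_map_germ_apply (basicOpens W) F hW T.f.hom t).trans ?_
  rw [ht']
  exact (TopCat.Presheaf.germ_res_apply T.X₂.obj (homOfLE h'') F hW _).trans
    (TopCat.Presheaf.germ_res_apply T.X₂.obj (homOfLE h) F hV s)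

end TopFilter

/-- If the functor `G ↦ (f_* G)_y` is exact, then `R^n f_* G` vanishes at `y` for all `n ≥ 1`. -/
theorem isZero_stalk_higherDirectImage_of_exact {Y : TopCat.{u}} (f : X ⟶ Y) (y : Y)
    (hf : ∀ S : ShortComplex (TopCat.Sheaf AddCommGrpCat.{u} X), S.Exact →
      ((S.map (TopCat.Sheaf.pushforward AddCommGrpCat.{u} f)).map
        (TopCat.Sheaf.forget _ _ ⋙ TopCat.Presheaf.stalkFunctor AddCommGrpCat.{u} y)).Exact)
    (G : TopCat.Sheaf AddCommGrpCat.{u} X) {n : ℕ} (hn : 1 ≤ n) :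
    IsZero (((higherDirectImage f n).obj G).presheaf.stalk y) := by
  obtain ⟨n, rfl⟩ := Nat.exists_eq_add_of_le' hn
  let L := TopCat.Sheaf.forget AddCommGrpCat.{u} Y ⋙
    TopCat.Presheaf.stalkFunctor AddCommGrpCat.{u} y
  let I := InjectiveResolution.of G
  let S := I.cocomplex.sc (n + 1)
  have hS : S.Exact := I.cocomplex_exactAt_succ n
  let T := S.map (TopCat.Sheaf.pushforward AddCommGrpCat.{u} f)
  -- `L` preserves homology, so the stalk of the homology of `T` is the homology of its stalks.
  have hT : IsZero (L.obj T.homology) :=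
    ((ShortComplex.exact_iff_isZero_homology _).1 (hf S hS)).of_iso (T.mapHomologyIso L).symm
  exact hT.of_iso (L.mapIso (I.isoRightDerivedObj (TopCat.Sheaf.pushforward _ f) (n + 1)))

end

theorem mainTheorem4 (X : TopCat.{u}) (F : TopFilter X) (hF : F.IsIrreducible) :
    (∀ S : ShortComplex (TopCat.Sheaf AddCommGrpCat.{u} X), S.Exact →
      Function.Exact ((generalizedStalk F).map S.f) ((generalizedStalk F).map S.g)) ∧
    ∀ (G : TopCat.Sheaf AddCommGrpCat.{u} X) (n : ℕ), 1 ≤ n →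
      IsZero ((cohomologySheaf n G).presheaf.stalk (F : filtrum X)) :=
  ⟨fun _ hS ↦ generalizedStalk.exact_of_isIrreducible hF hS, fun G _ hn ↦
    isZero_stalk_higherDirectImage_of_exact (toFiltrum X) F
      (fun _ hS ↦ hF.exact_stalk_pushforward hS) G hn⟩
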